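/- Let $\Omega\subset\mathbb{R}^3$ be a bounded domain with smooth boundary, let $\nu>0$, let $H$ be the closure in $L^2(\Omega)^3$ of the space of smooth divergence-free vector fields with compact support in $\Omega$, let $V$ be the closure of the same space in $H_0^1(\Omega)^3$, and let $\mathbf f\in H$. Consider the three-dimensional incompressible Navier–Stokes equations $$\partial_t\mathbf u-\nu\Delta\mathbf u+(\mathbf u\cdot\nabla)\mathbf u+\nabla p=\mathbf f,\qquad \nabla\cdot\mathbf u=0\quad\text{in }(0,\infty)\times\Omega,\qquad \mathbf u=0\quad\text{on }(0,\infty)\times\partial\Omega .$$ Let $H_{\mathrm w}$ be $H$ with its weak topology, and let $\mathcal C_{\mathrm w}=\mathcal C_{\mathrm{loc}}([0,\infty),H_{\mathrm w})$ be the space of continuous functions from $[0,\infty)$ to $H_{\mathrm w}$ with the topology of uniform convergence on compact subintervals. A Leray–Hopf weak solution on $[0,\infty)$ is a $\mathbf u\in\mathcal C_{\mathrm w}$ that belongs to $L^\infty_{\mathrm{loc}}(0,\infty;H)\cap L^2_{\mathrm{loc}}(0,\infty;V)$, satisfies the equations in the weak sense against all test functions in $V$, is strongly continuous in $H$ from the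 right at $t=0$, and satisfies the energy inequality $\frac12\frac{d}{dt}\|\mathbf u\|_{L^2}^2+\nu\|\nabla\mathbf u\|_{L^2}^2\le(\mathbf f,\mathbf u)_{L^2}$ in the sense of distributions. An invariant Vishik–Fursikov measure is a Borel probability measure $\rho$ on $\mathcal C_{\mathrm w}$ that is carried by the set of Leray–Hopf weak solutions and satisfies $\rho(\sigma_\tau^{-1}\mathcal E)=\rho(\mathcal E)$ for all $\tau\ge 0$ and all Borel sets $\mathcal E\subset\mathcal C_{\mathrm w}$, where $(\sigma_\tau\mathbf u)(t)=\mathbf u(t+\tau)$. The projection of such a measure under $\mathbf u\mapsto\mathbf u(0)$ is called a Vishik–Fursikov stationary statistical solution on $H$. A generalized limit is a positive bounded linear functional on $L^\infty(0,\infty)$ that extends the classical limit as $T\to\infty$. Let $\rho$ be an invariant Vishik–Fursikov measure and let $\mathrm{Lim}_{T\to\infty}$ and $\mathrm{Lim}'_{T\to\infty}$ be two generalized limits. Then, for $\rho$-almost every Leray–Hopf weak solution $\mathbf u$, the time-average stationary statistical solutions $\mu_{\mathbf u}$ and $\mu_{\mathbf u}'$ on $H$, determined by $$\operatorname*{Lim}_{T\to\infty}\frac1T\int_0^T\Phi(\mathbf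 u(t))\,dt=\int_H\Phi\,d\mu_{\mathbf u},\qquad \operatorname*{Lim}_{T\to\infty}{}'\,\frac1T\int_0^T\Phi(\mathbf u(t))\,dt=\int_H\Phi\,d\mu_{\mathbf u}'$$ for all bounded weakly continuous functions $\Phi:H\to\mathbb R$, exist and coincide. That is, for $\rho$-almost every $\mathbf u$: (i) there is a Vishik–Fursikov stationary statistical solution $\mu$ that satisfies both families of identities; and (ii) whenever a Borel probability measure $\mu_{\mathbf u}$ satisfies the first family and a Borel probability measure $\mu_{\mathbf u}'$ satisfies the second, $\mu_{\mathbf u}=\mu_{\mathbf u}'$. -/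

import Mathlib

open MeasureTheory Set Filter Topology
open scoped ENNReal NNReal ContDiff

namespace NSE

noncomputable section

/-- Physical space. -/
abbrev E3 : Type := EuclideanSpace ℝ (Fin 3)

/-- The value of a velocity gradient at a point: its `j`-th entry is the `j`-th partial derivative
of the velocity. The norm is the Euclidean (Frobenius) norm. -/
abbrev Grad : Type := PiLp 2 (fun _ : Fin 3 => E3)

/-- The gradient of a differentiable vector field. -/
def grad (φ : E3 → E3) (x : E3) : Grad :=
  WithLp.toLp 2 fun j => fderiv ℝ φ x (EuclideanSpace.single j 1)

/-- Bounded domains (nonempty connected open sets) with `C^∞` boundary: near each boundary point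
the domain is the negativity set of a smooth function with nonvanishing differential. -/
structure IsBoundedSmoothDomain (Ω : Set E3) : Prop where
  isOpen : IsOpen Ω
  isConnected : IsConnected Ω
  isBounded : Bornology.IsBounded Ω
  smooth_boundary : ∀ x ∈ frontier Ω, ∃ (U : Set E3) (g : E3 → ℝ), IsOpen U ∧ x ∈ U ∧
    ContDiffOn ℝ ∞ g U ∧ g x = 0 ∧ fderiv ℝ g x ≠ 0 ∧ ∀ y ∈ U, (y ∈ Ω ↔ g y < 0)

/-- Smooth divergence-free vector fields with compact support in `Ω`. -/
structure IsTestField (Ω : Set E3) (φ : E3 → E3) : Prop where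
  smooth : ContDiff ℝ ∞ φ
  hasCompactSupport : HasCompactSupport φ
  tsupport_subset : tsupport φ ⊆ Ω
  div_eq_zero : ∀ x, ∑ j : Fin 3, grad φ x j j = 0

/-- `L²(Ω)³`. -/
abbrev L2 (Ω : Set E3) : Type := Lp E3 2 (volume.restrict Ω)

/-- `L²(Ω)^{3×3}`, the space of gradients. -/
abbrev L2Grad (Ω : Set E3) : Type := Lp Grad 2 (volume.restrict Ω)

/-- The phase space `H`: the closure in `L²(Ω)³` of the (linear) space of test fields. -/
def H (Ω : Set E3) : Submodule ℝ (L2 Ω) :=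
  (Submodule.span ℝ {v : L2 Ω | ∃ φ : E3 → E3, IsTestField Ω φ ∧
    (v : E3 → E3) =ᵐ[volume.restrict Ω] φ}).topologicalClosure

/-- The space `V`, the closure of the test fields in `H₀¹(Ω)³`, each element `v` being recorded
together with its gradient as the pair `(v, ∇v)`. -/
def V (Ω : Set E3) : Submodule ℝ (L2 Ω × L2Grad Ω) :=
  (Submodule.span ℝ {p : L2 Ω × L2Grad Ω | ∃ φ : E3 → E3, IsTestField Ω φ ∧
    (p.1 : E3 → E3) =ᵐ[volume.restrict Ω] φ ∧
    (p.2 : E3 → Grad) =ᵐ[volume.restrict Ω] grad φ}).topologicalClosure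

/-- The trilinear term `∫_Ω ((u · ∇)w) · v dx`, where `Gw` is the gradient of `w`. -/
def trilinear (Ω : Set E3) (u : L2 Ω) (Gw : L2Grad Ω) (v : L2 Ω) : ℝ :=
  ∫ x in Ω, inner ℝ (∑ j : Fin 3, u x j • Gw x j) (v x)

/-- `H` with its weak topology. -/
abbrev Hw (Ω : Set E3) : Type := WeakSpace ℝ (H Ω)

instance instMeasurableSpaceHw (Ω : Set E3) : MeasurableSpace (Hw Ω) := borel (Hw Ω)

instance instBorelSpaceHw (Ω : Set E3) : BorelSpace (Hw Ω) := ⟨rfl⟩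

/-- `C_loc([0,∞), H_w)`. Its topology, the compact-open one, is that of uniform convergence on
compact subintervals with values in `H_w`. -/
abbrev Cw (Ω : Set E3) : Type := C(ℝ≥0, Hw Ω)

instance instMeasurableSpaceCw (Ω : Set E3) : MeasurableSpace (Cw Ω) := borel (Cw Ω)

instance instBorelSpaceCw (Ω : Set E3) : BorelSpace (Cw Ω) := ⟨rfl⟩

variable {Ω : Set E3}

/-- `u(t)` as an element of the Hilbert space `H`, for real `t ≥ 0`. -/
def Cw.at (u : Cw Ω) (t : ℝ) : H Ω := (toWeakSpace ℝ (H Ω)).symm (u t.toNNReal)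

/-- The time translation `σ_τ`. -/
def shift (τ : ℝ≥0) (u : Cw Ω) : Cw Ω :=
  u.comp ⟨fun t => t + τ, by fun_prop⟩

/-- The projection `Π₀`, evaluation at time `0`. -/
def proj0 (u : Cw Ω) : Hw Ω := u 0

/-- Scalar test functions on the open time interval `(0,∞)`. -/
structure IsTimeTest (θ : ℝ → ℝ) : Prop where
  smooth : ContDiff ℝ ∞ θ
  hasCompactSupport : HasCompactSupport θ
  tsupport_subset : tsupport θ ⊆ Ioi 0

/-- `u` is a Leray-Hopf weak solution on `[0,∞)` of the Navier-Stokes equations with viscosity `ν`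
and force `f`, and `G(t)` is the gradient of `u(t)`. -/
structure IsLerayHopfWith (ν : ℝ) (f : H Ω) (u : Cw Ω) (G : ℝ → L2Grad Ω) : Prop where
  /-- `u ∈ L^∞_loc(0,∞; H)` -/
  bounded : ∀ T : ℝ, ∃ C : ℝ, ∀ t ∈ Icc 0 T, ‖u.at t‖ ≤ C
  /-- `u ∈ L²_loc(0,∞; V)` -/
  mem_V : ∀ᵐ t ∂volume.restrict (Ioi (0 : ℝ)), ((u.at t : L2 Ω), G t) ∈ V Ω
  memLp_grad : ∀ T : ℝ, 0 < T → MemLp G 2 (volume.restrict (Ioc 0 T))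
  /-- The equation `d/dt (u,v) + ν (∇u,∇v) + ((u·∇)u,v) = (f,v)` holds in the sense of
  distributions on `(0,∞)` for every test function `v ∈ V`. -/
  weak_form : ∀ v ∈ V Ω, ∀ θ : ℝ → ℝ, IsTimeTest θ →
    -(∫ t in Ioi (0 : ℝ), inner ℝ (u.at t : L2 Ω) v.1 * deriv θ t)
      + ∫ t in Ioi (0 : ℝ), (ν * inner ℝ (G t) v.2 + trilinear Ω (u.at t) (G t) v.1) * θ t
    = ∫ t in Ioi (0 : ℝ), inner ℝ (f : L2 Ω) v.1 * θ t
  /-- strong continuity from the right at the initial time -/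
  right_cont : Tendsto u.at (𝓝[>] 0) (𝓝 (u.at 0))
  /-- The energy inequality `½ d/dt ‖u‖² + ν ‖∇u‖² ≤ (f,u)` in the sense of distributions. -/
  energy : ∀ θ : ℝ → ℝ, IsTimeTest θ → (∀ t, 0 ≤ θ t) →
    -(∫ t in Ioi (0 : ℝ), (1 / 2) * ‖u.at t‖ ^ 2 * deriv θ t)
      + ∫ t in Ioi (0 : ℝ), ν * ‖G t‖ ^ 2 * θ t
    ≤ ∫ t in Ioi (0 : ℝ), inner ℝ f (u.at t) * θ t

/-- Leray-Hopf weak solutions on `[0,∞)`. -/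
def IsLerayHopf (ν : ℝ) (f : H Ω) (u : Cw Ω) : Prop :=
  ∃ G : ℝ → L2Grad Ω, IsLerayHopfWith ν f u G

/-- Invariant (space-time) Vishik-Fursikov measures: Borel probability measures on `C_w` carried by
the set of Leray-Hopf weak solutions and invariant under time translations. -/
structure IsInvariantVF (ν : ℝ) (f : H Ω) (ρ : Measure (Cw Ω)) : Prop where
  isProbabilityMeasure : IsProbabilityMeasure ρ
  carried : ∀ᵐ u ∂ρ, IsLerayHopf ν f u
  invariant : ∀ (τ : ℝ≥0) (A : Set (Cw Ω)), MeasurableSet A → ρ (shift τ ⁻¹' A) = ρ A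

/-- Vishik-Fursikov stationary statistical solutions: the projections `Π₀ρ` of the invariant
Vishik-Fursikov measures `ρ`. -/
def IsVFStationary (ν : ℝ) (f : H Ω) (μ : Measure (Hw Ω)) : Prop :=
  ∃ ρ : Measure (Cw Ω), IsInvariantVF ν f ρ ∧ μ = ρ.map proj0

/-- `L^∞(0,∞)`. -/
abbrev LInfty : Type := Lp ℝ ∞ (volume.restrict (Ioi (0 : ℝ)))

/-- Generalized limits as `T → ∞`: positive bounded linear functionals on `L^∞(0,∞)` which extend
the classical limit. -/
structure IsGeneralizedLimit (L : LInfty →L[ℝ] ℝ) : Prop where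
  nonneg : ∀ F : LInfty, 0 ≤ F → 0 ≤ L F
  extends_lim : ∀ (g : ℝ → ℝ) (hg : MemLp g ∞ (volume.restrict (Ioi (0 : ℝ)))) (l : ℝ),
    Tendsto g atTop (𝓝 l) → L (hg.toLp g) = l

/-- The time average `T ↦ (1/T) ∫₀ᵀ Φ(u(t)) dt`. -/
def timeAverage (Φ : Hw Ω → ℝ) (u : Cw Ω) (T : ℝ) : ℝ :=
  (1 / T) * ∫ t in (0 : ℝ)..T, Φ (u t.toNNReal)

/-- The measure `μ` on `H` represents the generalized limits of the time averages of `u`: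
`Lim_{T→∞} (1/T) ∫₀ᵀ Φ(u(t)) dt = ∫_H Φ dμ` for every bounded weakly continuous `Φ : H → ℝ`. -/
def RepresentsTimeAverages (L : LInfty →L[ℝ] ℝ) (u : Cw Ω) (μ : Measure (Hw Ω)) : Prop :=
  ∀ Φ : BoundedContinuousFunction (Hw Ω) ℝ,
    ∃ h : MemLp (timeAverage Φ u) ∞ (volume.restrict (Ioi (0 : ℝ))),
      L (h.toLp _) = ∫ v, Φ v ∂μ

end

end NSE

/-! The Navier–Stokes equations enter only through the set that carries `ρ`; the rest is ergodic
theory on path space. Disintegrate `ρ` over the σ-algebra of translation-invariant events. For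
almost every `u` the conditional measure `κ` is again invariant and carried by Leray–Hopf solutions,
so `μ = κ.map proj0` is a stationary statistical solution. By the ergodic theorem the time averages
of `u` converge classically to integrals against `μ`, and every generalized limit must return that
value.

Two points need care. Disintegration requires path space to be standard Borel although `Hw` need not
be metrizable: weakly closed balls are compact and coordinates against a dense sequence induce their
topology, so path space embeds as a Borel set in the Polish space of continuous paths in `ℕ → ℝ`
(`measurableEmbedding_pathCoord`). Next, a single null set must serve all `Φ`. For each Borel set,
lower visiting frequency dominates conditional probability (`condExpKernel_le_lowerFreq`, from the
maximal ergodic inequality). Applied to finite unions from a countable network, this yields the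
open-set portmanteau condition (`le_liminf_of_network`), hence weak convergence of the empirical
measures. -/

namespace MeasurableEmbedding

/-- Pulling Borel sets back along an injection with measurable range detects measurability. -/
lemma of_exists_preimage {α β : Type*} [MeasurableSpace α] [MeasurableSpace β] {f : α → β}
    (hf : Measurable f) (hinj : Function.Injective f) (hrange : MeasurableSet (range f))
    (h : ‹MeasurableSpace α› ≤ MeasurableSpace.comap f ‹MeasurableSpace β›) :
    MeasurableEmbedding f where
  injective := hinj
  measurable := hf
  measurableSet_image' := by
    intro s hs
    obtain ⟨t, ht, rfl⟩ := h s hs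
    rw [image_preimage_eq_inter_range]
    exact ht.inter hrange

lemma standardBorelSpace {α β : Type*} [MeasurableSpace α] [MeasurableSpace β]
    [StandardBorelSpace β] {f : α → β} (hf : MeasurableEmbedding f) : StandardBorelSpace α := by
  have := hf.measurableSet_range.standardBorel
  let := upgradeStandardBorel (range f)
  let : TopologicalSpace α := TopologicalSpace.induced hf.equivRange inferInstance
  exact ⟨inferInstance, hf.equivRange.measurableEmbedding.borelSpace ⟨rfl⟩,
    hf.equivRange.toEquiv.polishSpace_induced⟩

end MeasurableEmbedding

/-! ### Borel structure of the weak space and of its path space -/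

namespace WeakSpace

variable {E : Type*} [NormedAddCommGroup E] [InnerProductSpace ℝ E]

lemma continuous_inner_left (v : E) :
    Continuous fun x : WeakSpace ℝ E => inner ℝ v ((toWeakSpace ℝ E).symm x) :=
  WeakBilin.eval_continuous (topDualPairing ℝ E).flip (innerSL ℝ v)

variable (E) in
/-- The closed ball of radius `r` about the origin, as a subset of the weak space. -/
def ball (r : ℝ) : Set (WeakSpace ℝ E) := {x | ‖(toWeakSpace ℝ E).symm x‖ ≤ r}

/-- Banach–Alaoglu, carried from the weak-* dual by the Riesz isomorphism. -/
lemma isCompact_ball [CompleteSpace E] (r : ℝ) : IsCompact (ball E r) := by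
  let g : WeakDual ℝ E → WeakSpace ℝ E := fun ψ =>
    toWeakSpace ℝ E ((InnerProductSpace.toDual ℝ E).symm (WeakDual.toStrongDual ψ))
  have hg : Continuous g := by
    refine WeakBilin.continuous_of_continuous_eval _ fun l => ?_
    have : ∀ ψ : WeakDual ℝ E, (topDualPairing ℝ E).flip (g ψ) l
        = ψ ((InnerProductSpace.toDual ℝ E).symm l) := by
      intro ψ
      change l ((InnerProductSpace.toDual ℝ E).symm (WeakDual.toStrongDual ψ)) = _
      rw [← InnerProductSpace.toDual_symm_apply (𝕜 := ℝ) (E := E), real_inner_comm,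
        InnerProductSpace.toDual_symm_apply]
      rfl
    simp_rw [this]
    exact WeakDual.eval_continuous _
  convert (WeakDual.isCompact_closedBall (𝕜 := ℝ) (E := E) 0 r).image hg using 1
  ext x
  constructor
  · intro hx
    refine ⟨StrongDual.toWeakDual
      (InnerProductSpace.toDual ℝ E ((toWeakSpace ℝ E).symm x)), ?_, ?_⟩
    · simpa [ball] using hx
    · simp [g]
  · rintro ⟨ψ, hψ, rfl⟩
    simpa [ball, g] using hψ

/-- Uniform boundedness: each functional is bounded on a weakly compact set, so the norms are
bounded too. -/
lemma exists_subset_ball_of_isCompact [CompleteSpace E] {K : Set (WeakSpace ℝ E)}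
    (hK : IsCompact K) : ∃ m : ℕ, K ⊆ ball E m := by
  obtain ⟨C, hC⟩ := banach_steinhaus (𝕜 := ℝ) (𝕜₂ := ℝ) (σ₁₂ := RingHom.id ℝ)
    (g := fun x : K => innerSL ℝ ((toWeakSpace ℝ E).symm (x : WeakSpace ℝ E))) (by
      intro v
      obtain ⟨C, hC⟩ := (hK.image (continuous_inner_left v)).isBounded.exists_norm_le
      refine ⟨C, fun x => ?_⟩
      simpa [real_inner_comm] using hC _ ⟨x, x.2, rfl⟩)
  obtain ⟨m, hm⟩ := exists_nat_ge C
  refine ⟨m, fun x hx => ?_⟩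
  have := hC ⟨x, hx⟩
  rw [innerSL_apply_norm] at this
  exact this.trans hm

lemma exists_mapsTo_ball [CompleteSpace E] (u : C(ℝ≥0, WeakSpace ℝ E)) (n : ℝ≥0) :
    ∃ m : ℕ, MapsTo u (Iic n) (ball E m) := by
  have hc : IsCompact (Iic n) := by rw [← Icc_bot]; exact isCompact_Icc
  obtain ⟨m, hm⟩ := exists_subset_ball_of_isCompact (hc.image u.continuous)
  exact ⟨m, mapsTo_iff_image_subset.2 hm⟩

lemma iUnion_ball : ⋃ m : ℕ, ball E m = univ := by
  refine eq_univ_of_forall fun x => mem_iUnion.2 ?_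
  exact exists_nat_ge ‖(toWeakSpace ℝ E).symm x‖

variable [SecondCountableTopology E]

/-- Inner products against a dense sequence, as coordinates on the weak space. -/
noncomputable def coord (x : WeakSpace ℝ E) (k : ℕ) : ℝ :=
  inner ℝ (TopologicalSpace.denseSeq E k) ((toWeakSpace ℝ E).symm x)

lemma continuous_coord : Continuous (coord : WeakSpace ℝ E → ℕ → ℝ) :=
  continuous_pi fun _ => continuous_inner_left _

lemma coord_injective : Function.Injective (coord : WeakSpace ℝ E → ℕ → ℝ) := by
  intro x y h
  apply (toWeakSpace ℝ E).symm.injective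
  exact (TopologicalSpace.denseRange_denseSeq E).eq_of_inner_right ℝ (congrFun h)

instance : T2Space (WeakSpace ℝ E) :=
  T2Space.of_injective_continuous coord_injective continuous_coord

lemma coord_image_ball_inter (C : Set (WeakSpace ℝ E)) (m : ℕ) (x : WeakSpace ℝ E) :
    coord x ∈ coord '' (C ∩ ball E m) ↔ x ∈ C ∧ x ∈ ball E m :=
  coord_injective.mem_set_image

/-- Coordinates of a weakly continuous path. -/
noncomputable def pathCoord (u : C(ℝ≥0, WeakSpace ℝ E)) : C(ℝ≥0, ℕ → ℝ) :=
  ContinuousMap.comp ⟨coord, continuous_coord⟩ u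

lemma continuous_pathCoord :
    Continuous (pathCoord : C(ℝ≥0, WeakSpace ℝ E) → C(ℝ≥0, ℕ → ℝ)) :=
  ContinuousMap.continuous_postcomp _

lemma pathCoord_injective :
    Function.Injective (pathCoord : C(ℝ≥0, WeakSpace ℝ E) → C(ℝ≥0, ℕ → ℝ)) :=
  ContinuousMap.postcomp_injective _ coord_injective

/-- Coordinate paths that stay up to time `n` in the image of the ball of radius `m`. -/
def coordBallPaths (E : Type*) [NormedAddCommGroup E] [InnerProductSpace ℝ E]
    [SecondCountableTopology E] (n m : ℕ) : Set C(ℝ≥0, ℕ → ℝ) :=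
  {w | MapsTo w (Iic (n : ℝ≥0)) (coord '' ball E m)}

lemma pathCoord_mem_coordBallPaths {u : C(ℝ≥0, WeakSpace ℝ E)} {n m : ℕ} :
    pathCoord u ∈ coordBallPaths E n m ↔ MapsTo u (Iic (n : ℝ≥0)) (ball E m) :=
  forall₂_congr fun _ _ => coord_injective.mem_set_image

variable [CompleteSpace E]

lemma isClosed_coord_image {C : Set (WeakSpace ℝ E)} (hC : IsClosed C) (m : ℕ) :
    IsClosed (coord '' (C ∩ ball E m)) :=
  (((isCompact_ball m).inter_left hC).image continuous_coord).isClosed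

/-- On a ball, the weak topology is induced by the coordinates. -/
lemma exists_isOpen_coord {U : Set (WeakSpace ℝ E)} (hU : IsOpen U) (m : ℕ) :
    ∃ W : Set (ℕ → ℝ), IsOpen W ∧ ∀ x ∈ ball E m, x ∈ U ↔ coord x ∈ W := by
  refine ⟨(coord '' (Uᶜ ∩ ball E m))ᶜ, (isClosed_coord_image hU.isClosed_compl m).isOpen_compl,
    fun x hx => ?_⟩
  rw [mem_compl_iff, coord_image_ball_inter]
  simp [hx]

section Borel

variable [MeasurableSpace (WeakSpace ℝ E)] [BorelSpace (WeakSpace ℝ E)]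

/-- A weakly closed set is a countable union of its compact intersections with balls, so its image
is σ-compact, hence Borel. -/
lemma measurableEmbedding_coord : MeasurableEmbedding (coord : WeakSpace ℝ E → ℕ → ℝ) := by
  have key : ∀ C : Set (WeakSpace ℝ E), IsClosed C → MeasurableSet (coord '' C) := by
    intro C hC
    rw [← inter_univ C, ← iUnion_ball, inter_iUnion, image_iUnion]
    exact MeasurableSet.iUnion fun m => (isClosed_coord_image hC m).measurableSet
  refine MeasurableEmbedding.of_exists_preimage continuous_coord.measurable coord_injective
    (by simpa using key univ isClosed_univ) ?_
  rw [BorelSpace.measurable_eq (α := WeakSpace ℝ E), borel_eq_generateFrom_isClosed]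
  refine MeasurableSpace.generateFrom_le fun C hC => ?_
  exact ⟨_, key C hC, coord_injective.preimage_image C⟩

/-- A sequence of Borel sets such that every weakly open set is the union of a subfamily. -/
lemma exists_seq_measurableSet_network :
    ∃ D : ℕ → Set (WeakSpace ℝ E), (∀ i, MeasurableSet (D i)) ∧
      ∀ O : Set (WeakSpace ℝ E), IsOpen O → ∀ x ∈ O, ∃ i, x ∈ D i ∧ D i ⊆ O := by
  obtain ⟨b, hbc, -, hb⟩ := TopologicalSpace.exists_countable_basis (ℕ → ℝ)
  have : Nonempty (b × ℕ) := by
    obtain ⟨v, hv, -⟩ := hb.exists_subset_of_mem_open (mem_univ (0 : ℕ → ℝ)) isOpen_univ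
    exact ⟨⟨⟨v, hv⟩, 0⟩⟩
  have : Countable b := hbc.to_subtype
  obtain ⟨e, he⟩ := exists_surjective_nat (b × ℕ)
  -- Basic open sets of `ℕ → ℝ` pulled back and cut by balls. The cut costs openness, but only
  -- inside a ball do the coordinates recover the weak topology.
  refine ⟨fun i => coord ⁻¹' (e i).1 ∩ ball E (e i).2, fun i => ?_, fun O hO x hx => ?_⟩
  · exact ((hb.isOpen (e i).1.2).preimage continuous_coord).measurableSet.inter
      (isCompact_ball _).measurableSet
  · obtain ⟨m, hm⟩ := mem_iUnion.1 (iUnion_ball (E := E) ▸ mem_univ x)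
    obtain ⟨W, hW, hWO⟩ := exists_isOpen_coord hO m
    obtain ⟨v, hv, hxv, hvW⟩ := hb.exists_subset_of_mem_open ((hWO x hm).1 hx) hW
    obtain ⟨i, hi⟩ := he (⟨v, hv⟩, m)
    refine ⟨i, ?_, ?_⟩
    · simpa [hi] using ⟨hxv, hm⟩
    · intro y hy
      simp only [hi] at hy
      exact (hWO y hy.2).2 (hvW hy.1)

/-- Test functions pulled back through `coord` already determine the image measures, and the
embedding loses no Borel sets. -/
lemma ext_of_forall_integral_eq {μ μ' : Measure (WeakSpace ℝ E)} [IsFiniteMeasure μ]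
    [IsFiniteMeasure μ']
    (h : ∀ Φ : BoundedContinuousFunction (WeakSpace ℝ E) ℝ, ∫ x, Φ x ∂μ = ∫ x, Φ x ∂μ') :
    μ = μ' := by
  have hm : Measurable (coord : WeakSpace ℝ E → ℕ → ℝ) := continuous_coord.measurable
  have : μ.map coord = μ'.map coord := by
    have := Measure.isFiniteMeasure_map μ (coord : WeakSpace ℝ E → ℕ → ℝ)
    have := Measure.isFiniteMeasure_map μ' (coord : WeakSpace ℝ E → ℕ → ℝ)
    refine ext_of_forall_integral_eq_of_IsFiniteMeasure fun f => ?_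
    rw [integral_map hm.aemeasurable f.continuous.aestronglyMeasurable,
      integral_map hm.aemeasurable f.continuous.aestronglyMeasurable]
    exact h (f.compContinuous ⟨coord, continuous_coord⟩)
  rw [← measurableEmbedding_coord.comap_map μ, this, measurableEmbedding_coord.comap_map]

end Borel

lemma isClosed_coordBallPaths (n m : ℕ) : IsClosed (coordBallPaths E n m) :=
  ContinuousMap.isClosed_setOfPred_mapsTo
    ((isCompact_ball (E := E) m).image continuous_coord).isClosed _

/-- Weakly continuous paths are locally bounded; conversely, a coordinate path that lifts pointwise
within a ball on each `[0, n]` has a weakly continuous lift. -/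
lemma range_pathCoord : range (pathCoord : C(ℝ≥0, WeakSpace ℝ E) → C(ℝ≥0, ℕ → ℝ))
    = ⋂ n : ℕ, ⋃ m : ℕ, coordBallPaths E n m := by
  ext w
  simp only [mem_iInter, mem_iUnion]
  constructor
  · rintro ⟨u, rfl⟩ n
    obtain ⟨m, hm⟩ := exists_mapsTo_ball u n
    exact ⟨m, pathCoord_mem_coordBallPaths.2 hm⟩
  · intro hw
    have hex : ∀ t, ∃ x : WeakSpace ℝ E, coord x = w t := by
      intro t
      obtain ⟨n, hn⟩ := exists_nat_ge t
      obtain ⟨m, hm⟩ := hw n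
      obtain ⟨x, -, hx⟩ := hm hn
      exact ⟨x, hx⟩
    choose u hu using hex
    have hcont : Continuous u := by
      refine continuous_iff_continuousAt.2 fun t => ?_
      -- The strict bound makes `Iic n` a neighbourhood of `t`.
      obtain ⟨n, hn⟩ := exists_nat_gt t
      obtain ⟨m, hm⟩ := hw n
      have hball : ∀ s ∈ Iic (n : ℝ≥0), u s ∈ ball E m := fun s hs => by
        have := hm hs
        rwa [← hu, coord_injective.mem_set_image] at this
      refine (nhds_basis_opens (u t)).tendsto_right_iff.2 fun O hO => ?_
      obtain ⟨W, hW, hWO⟩ := exists_isOpen_coord hO.2 m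
      have h1 : ∀ᶠ s in 𝓝 t, w s ∈ W := w.continuous.continuousAt.eventually_mem
        (hW.mem_nhds (by rw [← hu]; exact (hWO _ (hball t hn.le)).1 hO.1))
      filter_upwards [h1, Iic_mem_nhds hn] with s hs hsn
      exact (hWO _ (hball s hsn)).2 (by rwa [hu])
    exact ⟨⟨u, hcont⟩, ContinuousMap.ext hu⟩

/-- On paths bounded by `m` up to time `n`, neighbourhoods controlling the path up to time `n` come
from neighbourhoods of the coordinate path. -/
lemma exists_isOpen_pathCoord {O : Set C(ℝ≥0, WeakSpace ℝ E)} (hO : IsOpen O)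
    {u : C(ℝ≥0, WeakSpace ℝ E)} (hu : u ∈ O) :
    ∃ (n m : ℕ) (G : Set C(ℝ≥0, ℕ → ℝ)), IsOpen G ∧ pathCoord u ∈ G ∩ coordBallPaths E n m ∧
      pathCoord ⁻¹' (G ∩ coordBallPaths E n m) ⊆ O := by
  obtain ⟨S, hSf, hS, hSO⟩ := ContinuousMap.mem_nhds_iff.1 (hO.mem_nhds hu)
  have hK : IsCompact (⋃ p ∈ S, p.1) := hSf.isCompact_biUnion fun p hp => (hS p.1 p.2 hp).1
  obtain ⟨c, hc⟩ := hK.bddAbove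
  obtain ⟨n, hn⟩ := exists_nat_ge c
  have hKn : ∀ p ∈ S, p.1 ⊆ Iic (n : ℝ≥0) := fun p hp t ht =>
    (hc (mem_biUnion hp ht)).trans hn
  obtain ⟨m, hm⟩ := exists_mapsTo_ball u n
  choose! W hWo hWU using fun (p : Set ℝ≥0 × Set (WeakSpace ℝ E)) (hp : p ∈ S) =>
    exists_isOpen_coord (hS p.1 p.2 hp).2.1 m
  refine ⟨n, m, ⋂ p ∈ S, {w | MapsTo w p.1 (W p)}, hSf.isOpen_biInter fun p hp =>
    ContinuousMap.isOpen_setOfPred_mapsTo (hS p.1 p.2 hp).1 (hWo p hp),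
    ⟨mem_iInter₂.2 fun p hp t ht => ?_, pathCoord_mem_coordBallPaths.2 hm⟩, ?_⟩
  · exact (hWU p hp _ (hm (hKn p hp ht))).1 ((hS p.1 p.2 hp).2.2 ht)
  · rintro v ⟨hvG, hvB⟩
    rw [pathCoord_mem_coordBallPaths] at hvB
    refine hSO fun K U hKU t ht => ?_
    exact (hWU (K, U) hKU _ (hvB (hKn _ hKU ht))).2 (mem_iInter₂.1 hvG (K, U) hKU ht)

variable [MeasurableSpace C(ℝ≥0, WeakSpace ℝ E)] [BorelSpace C(ℝ≥0, WeakSpace ℝ E)]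

lemma measurableEmbedding_pathCoord [MeasurableSpace C(ℝ≥0, ℕ → ℝ)] [BorelSpace C(ℝ≥0, ℕ → ℝ)] :
    MeasurableEmbedding (pathCoord : C(ℝ≥0, WeakSpace ℝ E) → C(ℝ≥0, ℕ → ℝ)) := by
  refine MeasurableEmbedding.of_exists_preimage continuous_pathCoord.measurable
    pathCoord_injective ?_ ?_
  · rw [range_pathCoord]
    exact MeasurableSet.iInter fun n => MeasurableSet.iUnion fun m =>
      (isClosed_coordBallPaths n m).measurableSet
  · rw [BorelSpace.measurable_eq (α := C(ℝ≥0, WeakSpace ℝ E))]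
    refine MeasurableSpace.generateFrom_le fun O hO => ?_
    -- The largest admissible open set for each pair: only the union over `n` and `m` must be
    -- countable.
    let G (n m : ℕ) : Set C(ℝ≥0, ℕ → ℝ) :=
      ⋃₀ {G | IsOpen G ∧ pathCoord ⁻¹' (G ∩ coordBallPaths E n m) ⊆ O}
    refine ⟨⋃ n, ⋃ m, G n m ∩ coordBallPaths E n m, ?_, ?_⟩
    · exact MeasurableSet.iUnion fun n => MeasurableSet.iUnion fun m =>
        (isOpen_sUnion fun _ h => h.1).measurableSet.inter
          (isClosed_coordBallPaths n m).measurableSet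
    · ext u
      simp only [mem_preimage, mem_iUnion]
      constructor
      · rintro ⟨n, m, ⟨V, hV, huV⟩, huB⟩
        exact hV.2 ⟨huV, huB⟩
      · intro hu
        obtain ⟨n, m, V, hV, ⟨huV, huB⟩, hVO⟩ := exists_isOpen_pathCoord hO hu
        exact ⟨n, m, ⟨V, ⟨hV, hVO⟩, huV⟩, huB⟩

lemma standardBorelSpace_paths : StandardBorelSpace C(ℝ≥0, WeakSpace ℝ E) := by
  let : MeasurableSpace C(ℝ≥0, ℕ → ℝ) := borel _
  have : BorelSpace C(ℝ≥0, ℕ → ℝ) := ⟨rfl⟩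
  have : StandardBorelSpace C(ℝ≥0, ℕ → ℝ) := inferInstance
  exact measurableEmbedding_pathCoord.standardBorelSpace

end WeakSpace

/-! ### The maximal ergodic inequality -/

section MaximalErgodic

variable {X : Type*}

/-- The maximum of `0` and the first `n` Birkhoff sums of `f`. -/
noncomputable def maxBirkhoffSum (T : X → X) (f : X → ℝ) : ℕ → X → ℝ
  | 0, _ => 0
  | n + 1, x => max 0 (f x + maxBirkhoffSum T f n (T x))

variable {T : X → X} {f : X → ℝ}

lemma maxBirkhoffSum_nonneg (n : ℕ) (x : X) : 0 ≤ maxBirkhoffSum T f n x := by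
  cases n
  · exact le_rfl
  · exact le_max_left _ _

lemma maxBirkhoffSum_le_succ (n : ℕ) (x : X) :
    maxBirkhoffSum T f n x ≤ maxBirkhoffSum T f (n + 1) x := by
  induction n generalizing x with
  | zero => exact maxBirkhoffSum_nonneg _ _
  | succ n ih => exact max_le_max le_rfl (add_le_add_right (ih (T x)) _)

lemma birkhoffSum_le_maxBirkhoffSum (n : ℕ) (x : X) :
    birkhoffSum T f n x ≤ maxBirkhoffSum T f n x := by
  induction n generalizing x with
  | zero => simp [maxBirkhoffSum]
  | succ n ih =>
    rw [birkhoffSum_succ']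
    exact (add_le_add_right (ih (T x)) _).trans (le_max_right _ _)

/-- A positive maximum is not the `0` in the recursion, so it equals `f x` plus the previous maximum
at `T x`; monotonicity in `n` finishes. -/
lemma maxBirkhoffSum_sub_le {n : ℕ} {x : X} (h : 0 < maxBirkhoffSum T f n x) :
    maxBirkhoffSum T f n x - maxBirkhoffSum T f n (T x) ≤ f x := by
  cases n with
  | zero => exact absurd h (lt_irrefl _)
  | succ n =>
    have h1 : maxBirkhoffSum T f (n + 1) x = f x + maxBirkhoffSum T f n (T x) := by
      rcases lt_max_iff.1 h with h | h
      · exact absurd h (lt_irrefl _)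
      · exact max_eq_right h.le
    linarith [maxBirkhoffSum_le_succ (T := T) (f := f) n (T x)]

variable [MeasurableSpace X] {ρ : Measure X}

lemma measurable_maxBirkhoffSum (hT : Measurable T) (hf : Measurable f) (n : ℕ) :
    Measurable (maxBirkhoffSum T f n) := by
  induction n with
  | zero => exact measurable_const
  | succ n ih => exact measurable_const.max (hf.add (ih.comp hT))

lemma integrable_maxBirkhoffSum (hT : MeasurePreserving T ρ ρ) (hf : Integrable f ρ) (n : ℕ) :
    Integrable (maxBirkhoffSum T f n) ρ := by
  induction n with
  | zero => exact integrable_zero _ _ _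
  | succ n ih => exact (integrable_zero _ _ _).sup (hf.add (hT.integrable_comp_of_integrable ih))

/-- The maximal ergodic inequality. -/
lemma setIntegral_maxBirkhoffSum_pos_nonneg (hT : MeasurePreserving T ρ ρ) (hfm : Measurable f)
    (hf : Integrable f ρ) (n : ℕ) : 0 ≤ ∫ x in {x | 0 < maxBirkhoffSum T f n x}, f x ∂ρ := by
  set M := maxBirkhoffSum T f n
  have hMm : Measurable M := measurable_maxBirkhoffSum hT.measurable hfm n
  have hM : Integrable M ρ := integrable_maxBirkhoffSum hT hf n
  have hMT : Integrable (fun x => M (T x)) ρ := hT.integrable_comp_of_integrable hM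
  have hs : MeasurableSet {x | 0 < M x} := measurableSet_lt measurable_const hMm
  -- Garsia's argument: `M` vanishes off the set and `M ∘ T` is nonnegative there, so the left side
  -- is at least `∫ M - ∫ M ∘ T = 0`.
  have h1 : ∫ x in {x | 0 < M x}, (M x - M (T x)) ∂ρ ≤ ∫ x in {x | 0 < M x}, f x ∂ρ :=
    setIntegral_mono_on (hM.sub hMT).integrableOn hf.integrableOn hs
      fun x hx => maxBirkhoffSum_sub_le hx
  have h2 : ∫ x in {x | 0 < M x}, M x ∂ρ = ∫ x, M x ∂ρ :=
    setIntegral_eq_integral_of_forall_compl_eq_zero fun x hx =>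
      le_antisymm (not_lt.1 hx) (maxBirkhoffSum_nonneg n x)
  have h3 : ∫ x in {x | 0 < M x}, M (T x) ∂ρ ≤ ∫ x, M (T x) ∂ρ :=
    setIntegral_le_integral hMT (Eventually.of_forall fun x => maxBirkhoffSum_nonneg n (T x))
  have h4 : ∫ x, M (T x) ∂ρ = ∫ x, M x ∂ρ := by
    conv_rhs => rw [← hT.map_eq]
    exact (integral_map hT.measurable.aemeasurable hMm.aestronglyMeasurable).symm
  rw [integral_sub hM.integrableOn hMT.integrableOn] at h1
  linarith

/-- A function whose Birkhoff sums become positive at every point of an invariant set has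
nonnegative integral over that set. -/
lemma setIntegral_nonneg_of_exists_birkhoffSum_pos (hT : MeasurePreserving T ρ ρ)
    (hfm : Measurable f) (hf : Integrable f ρ) {B : Set X} (hB : MeasurableSet B)
    (hTB : T ⁻¹' B = B) (h : ∀ x ∈ B, ∃ n, 0 < birkhoffSum T f n x) :
    0 ≤ ∫ x in B, f x ∂ρ := by
  have hmem : ∀ x, T x ∈ B ↔ x ∈ B := fun x => by
    conv_rhs => rw [← hTB]
    rfl
  -- Truncation makes the sets where the maxima are positive increase exactly to `B`.
  set g := B.indicator f
  have hg : Integrable g ρ := hf.indicator hB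
  have hgm : Measurable g := hfm.indicator hB
  have hsum : ∀ n, ∀ x ∈ B, birkhoffSum T g n x = birkhoffSum T f n x := by
    intro n
    induction n with
    | zero => simp
    | succ n ih =>
      intro x hx
      rw [birkhoffSum_succ', birkhoffSum_succ', ih _ ((hmem x).2 hx)]
      simp [g, hx]
  have hzero : ∀ n, ∀ x ∉ B, maxBirkhoffSum T g n x = 0 := by
    intro n
    induction n with
    | zero => exact fun _ _ => rfl
    | succ n ih =>
      intro x hx
      have : g x = 0 := indicator_of_notMem hx f
      simp [maxBirkhoffSum, this, ih _ (mt (hmem x).1 hx)]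
  have hunion : ⋃ n, {x | 0 < maxBirkhoffSum T g n x} = B := by
    ext x
    simp only [mem_iUnion, mem_ofPred_eq]
    constructor
    · rintro ⟨n, hn⟩
      by_contra hx
      exact hn.ne' (hzero n x hx)
    · intro hx
      obtain ⟨n, hn⟩ := h x hx
      exact ⟨n, ((hsum n x hx).symm ▸ hn).trans_le (birkhoffSum_le_maxBirkhoffSum n x)⟩
  have hlim := tendsto_setIntegral_of_monotone (μ := ρ) (f := g)
    (s := fun n => {x | 0 < maxBirkhoffSum T g n x})
    (fun n => measurableSet_lt measurable_const (measurable_maxBirkhoffSum hT.measurable hgm n))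
    (monotone_nat_of_le_succ fun n x hx => lt_of_lt_of_le hx (maxBirkhoffSum_le_succ n x))
    hg.integrableOn
  rw [hunion] at hlim
  have : ∫ x in B, g x ∂ρ = ∫ x in B, f x ∂ρ :=
    setIntegral_congr_fun hB fun x hx => indicator_of_mem hx f
  rw [← this]
  exact ge_of_tendsto' hlim fun n => setIntegral_maxBirkhoffSum_pos_nonneg hT hgm hg n

end MaximalErgodic

/-! ### Time translations, occupation measures and visiting frequencies -/

namespace ContinuousMap

variable {Y : Type*} [TopologicalSpace Y]

/-- Translation of a path in time. -/
def translate (τ : ℝ≥0) (u : C(ℝ≥0, Y)) : C(ℝ≥0, Y) :=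
  u.comp ⟨fun t => t + τ, by fun_prop⟩

lemma translate_apply (τ t : ℝ≥0) (u : C(ℝ≥0, Y)) : translate τ u t = u (t + τ) := rfl

lemma continuous_translate (τ : ℝ≥0) : Continuous (translate τ : C(ℝ≥0, Y) → C(ℝ≥0, Y)) :=
  ContinuousMap.continuous_precomp _

lemma continuous_translate_time (u : C(ℝ≥0, Y)) : Continuous fun τ => translate τ u :=
  (ContinuousMap.curry ⟨fun p : ℝ≥0 × ℝ≥0 => u (p.2 + p.1), by fun_prop⟩).continuous

variable [MeasurableSpace C(ℝ≥0, Y)]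

lemma measurable_translate [BorelSpace C(ℝ≥0, Y)] (τ : ℝ≥0) :
    Measurable (translate τ : C(ℝ≥0, Y) → C(ℝ≥0, Y)) :=
  (continuous_translate τ).measurable

variable (Y) in
/-- The `σ`-algebra of measurable sets of paths invariant under all time translations. -/
abbrev translateInvariants : MeasurableSpace C(ℝ≥0, Y) :=
  ⨅ τ : ℝ≥0, MeasurableSpace.invariants (translate τ)

lemma measurableSet_translateInvariants {s : Set C(ℝ≥0, Y)} :
    MeasurableSet[translateInvariants Y] s ↔ MeasurableSet s ∧ ∀ τ, translate τ ⁻¹' s = s := by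
  rw [translateInvariants, MeasurableSpace.measurableSet_iInf]
  simp_rw [MeasurableSpace.measurableSet_invariants]
  exact forall_and.trans (and_congr_left' (forall_const _))

lemma translateInvariants_le : translateInvariants Y ≤ ‹MeasurableSpace C(ℝ≥0, Y)› :=
  fun _ hs => (measurableSet_translateInvariants.1 hs).1

lemma apply_translate_of_measurable {β : Type*} [MeasurableSpace β] [MeasurableSingletonClass β]
    {h : C(ℝ≥0, Y) → β} (hh : Measurable[translateInvariants Y] h) (τ : ℝ≥0) (u : C(ℝ≥0, Y)) :
    h (translate τ u) = h u :=
  congrFun (MeasurableSpace.comp_eq_of_measurable_invariants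
    (hh.mono (iInf_le _ τ) le_rfl)) u

lemma measurable_translateInvariants {β : Type*} [MeasurableSpace β] {h : C(ℝ≥0, Y) → β}
    (hh : Measurable h) (hinv : ∀ τ u, h (translate τ u) = h u) :
    Measurable[translateInvariants Y] h := by
  intro s hs
  refine measurableSet_translateInvariants.2 ⟨hh hs, fun τ => ?_⟩
  ext u
  simp [hinv]

end ContinuousMap

namespace ContinuousMap

variable {Y : Type*} [TopologicalSpace Y] [MeasurableSpace Y]

/-- The occupation measure of a path up to time `T`. -/
noncomputable def occupation (u : C(ℝ≥0, Y)) (T : ℝ≥0) : Measure Y :=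
  (volume.restrict (Ioc (0 : ℝ) T)).map fun t => u t.toNNReal

/-- The time averaged empirical measure up to the positive integer time `n + 1`. -/
noncomputable def empirical (u : C(ℝ≥0, Y)) (n : ℕ) : Measure Y :=
  (n + 1 : ℝ≥0∞)⁻¹ • occupation u (n + 1)

lemma empirical_apply (u : C(ℝ≥0, Y)) (n : ℕ) (s : Set Y) :
    empirical u n s = (n + 1 : ℝ≥0∞)⁻¹ * occupation u (n + 1) s := rfl

/-- The lower asymptotic frequency with which a path visits a set. -/
noncomputable def lowerFreq (u : C(ℝ≥0, Y)) (s : Set Y) : ℝ≥0∞ :=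
  liminf (fun n => empirical u n s) atTop

/-- A discrepancy bounded uniformly in time vanishes after division by `n + 1`. -/
lemma lowerFreq_le_of_occupation_le {u v : C(ℝ≥0, Y)} {s : Set Y} (τ : ℝ≥0)
    (h : ∀ T, occupation u T s ≤ occupation v T s + τ) : lowerFreq u s ≤ lowerFreq v s := by
  have hlim : Tendsto (fun n : ℕ => (n + 1 : ℝ≥0∞)⁻¹ * τ) atTop (𝓝 0) := by
    have h1 : Tendsto (fun n : ℕ => ((n + 1 : ℕ) : ℝ≥0∞)⁻¹) atTop (𝓝 0) :=
      (tendsto_add_atTop_iff_nat 1).2 ENNReal.tendsto_inv_nat_nhds_zero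
    have h2 := ENNReal.Tendsto.mul_const h1 (b := (τ : ℝ≥0∞)) (Or.inr ENNReal.coe_ne_top)
    simpa using h2
  rw [lowerFreq, lowerFreq,
    ← ENNReal.liminf_add_of_right_tendsto_zero hlim fun n => empirical v n s]
  refine liminf_le_liminf (Eventually.of_forall fun n => ?_)
  simp only [Pi.add_apply, empirical_apply, ← mul_add]
  exact mul_le_mul_right (h _) _

variable [BorelSpace Y]

lemma measurable_comp_toNNReal (u : C(ℝ≥0, Y)) : Measurable fun t : ℝ => u t.toNNReal :=
  (u.continuous.comp continuous_real_toNNReal).measurable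

lemma occupation_apply (u : C(ℝ≥0, Y)) (T : ℝ≥0) {s : Set Y} (hs : MeasurableSet s) :
    occupation u T s = volume ({t : ℝ | u t.toNNReal ∈ s} ∩ Ioc (0 : ℝ) T) := by
  rw [occupation, Measure.map_apply u.measurable_comp_toNNReal hs,
    Measure.restrict_apply (u.measurable_comp_toNNReal hs)]
  rfl

lemma occupation_univ (u : C(ℝ≥0, Y)) (T : ℝ≥0) : occupation u T univ = T := by
  rw [occupation_apply u T MeasurableSet.univ]
  simp

lemma occupation_le (u : C(ℝ≥0, Y)) (T : ℝ≥0) (s : Set Y) : occupation u T s ≤ T :=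
  (measure_mono (subset_univ s)).trans (occupation_univ u T).le

lemma occupation_add (u : C(ℝ≥0, Y)) (a b : ℝ≥0) :
    occupation u (a + b) = occupation u a + occupation (translate a u) b := by
  ext s hs
  have hms : MeasurableSet ({t : ℝ | u t.toNNReal ∈ s} ∩ Ioc (a : ℝ) (a + b)) :=
    (u.measurable_comp_toNNReal hs).inter measurableSet_Ioc
  rw [Measure.add_apply, occupation_apply _ _ hs, occupation_apply _ _ hs,
    occupation_apply _ _ hs, NNReal.coe_add,
    ← Ioc_union_Ioc_eq_Ioc (b := (a : ℝ)) a.coe_nonneg (le_add_of_nonneg_right b.coe_nonneg),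
    inter_union_distrib_left,
    measure_union ((Ioc_disjoint_Ioc_of_le le_rfl).mono inter_subset_right inter_subset_right) hms]
  congr 1
  rw [← measure_preimage_add_right volume (a : ℝ)]
  congr 1
  ext t
  simp only [mem_preimage, mem_inter_iff, mem_ofPred_eq, mem_Ioc, translate_apply]
  constructor
  · rintro ⟨h1, h2, h3⟩
    have ht : 0 < t := by linarith
    rw [Real.toNNReal_add ht.le a.coe_nonneg, Real.toNNReal_coe] at h1
    exact ⟨h1, ht, by linarith⟩
  · rintro ⟨h1, h2, h3⟩
    rw [Real.toNNReal_add h2.le a.coe_nonneg, Real.toNNReal_coe]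
    exact ⟨h1, by linarith, by linarith⟩

lemma toReal_occupation_add (u : C(ℝ≥0, Y)) (a b : ℝ≥0) (s : Set Y) :
    (occupation u (a + b) s).toReal
      = (occupation u a s).toReal + (occupation (translate a u) b s).toReal := by
  rw [occupation_add, Measure.add_apply, ENNReal.toReal_add]
  · exact ((occupation_le _ _ _).trans_lt ENNReal.coe_lt_top).ne
  · exact ((occupation_le _ _ _).trans_lt ENNReal.coe_lt_top).ne

/-- Passes from continuous to discrete time: successive unit-interval occupations add up to the
occupation up to time `n`. -/
lemma birkhoffSum_translate_one (s : Set Y) (c : C(ℝ≥0, Y) → ℝ)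
    (hc : ∀ u, c (translate 1 u) = c u) (n : ℕ) (u : C(ℝ≥0, Y)) :
    birkhoffSum (translate 1) (fun u => c u - (occupation u 1 s).toReal) n u
      = n * c u - (occupation u n s).toReal := by
  induction n generalizing u with
  | zero => simp [occupation]
  | succ n ih =>
    rw [birkhoffSum_succ', ih, hc, Nat.cast_succ, Nat.cast_succ, add_comm (n : ℝ≥0),
      toReal_occupation_add]
    ring

lemma integral_occupation (u : C(ℝ≥0, Y)) (T : ℝ≥0) {Φ : Y → ℝ}
    (hΦm : AEStronglyMeasurable Φ (occupation u T)) :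
    ∫ y, Φ y ∂(occupation u T) = ∫ t in (0 : ℝ)..T, Φ (u t.toNNReal) := by
  rw [occupation, integral_map u.measurable_comp_toNNReal.aemeasurable hΦm,
    intervalIntegral.integral_of_le T.coe_nonneg]

instance (u : C(ℝ≥0, Y)) (n : ℕ) : IsProbabilityMeasure (empirical u n) := by
  refine ⟨?_⟩
  rw [empirical_apply, occupation_univ]
  push_cast
  exact ENNReal.inv_mul_cancel (by simp) (by finiteness)

lemma lowerFreq_translate (u : C(ℝ≥0, Y)) (s : Set Y) (τ : ℝ≥0) :
    lowerFreq (translate τ u) s = lowerFreq u s := by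
  -- Both sides are the occupation up to `τ + T`, split at `τ` or at `T`.
  have key : ∀ T, occupation u τ s + occupation (translate τ u) T s
      = occupation u T s + occupation (translate T u) τ s := fun T => by
    rw [← Measure.add_apply, ← Measure.add_apply, ← occupation_add, ← occupation_add, add_comm]
  apply le_antisymm
  · refine lowerFreq_le_of_occupation_le τ fun T => ?_
    calc _ ≤ _ := le_add_self
      _ = _ := key T
      _ ≤ _ := by gcongr; exact occupation_le _ _ _
  · refine lowerFreq_le_of_occupation_le τ fun T => ?_
    calc _ ≤ _ := le_self_add
      _ = _ := (key T).symm
      _ ≤ _ := by rw [add_comm]; gcongr; exact occupation_le _ _ _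

variable [MeasurableSpace C(ℝ≥0, Y)]

lemma measurable_occupation (hY : Measurable fun p : C(ℝ≥0, Y) × ℝ≥0 => p.1 p.2) (T : ℝ≥0)
    {s : Set Y} (hs : MeasurableSet s) :
    Measurable fun u : C(ℝ≥0, Y) => occupation u T s := by
  have hm : Measurable fun p : C(ℝ≥0, Y) × ℝ => p.1 p.2.toNNReal :=
    hY.comp (measurable_fst.prodMk (measurable_real_toNNReal.comp measurable_snd))
  have := measurable_measure_prodMk_left (ν := volume.restrict (Ioc (0 : ℝ) T)) (hm hs)
  convert this using 2 with u
  exact Measure.map_apply u.measurable_comp_toNNReal hs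

lemma measurable_lowerFreq (hY : Measurable fun p : C(ℝ≥0, Y) × ℝ≥0 => p.1 p.2)
    {s : Set Y} (hs : MeasurableSet s) :
    Measurable[translateInvariants Y] fun u : C(ℝ≥0, Y) => lowerFreq u s :=
  measurable_translateInvariants
    (Measurable.liminf fun n => (measurable_occupation hY (n + 1) hs).const_mul _)
    fun τ u => lowerFreq_translate u s τ

end ContinuousMap

/-! ### Conditioning on invariant events -/

namespace ProbabilityTheory

variable {X : Type*} {m mX : MeasurableSpace X} [StandardBorelSpace X] {ρ : Measure X}
  [IsFiniteMeasure ρ]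

lemma compProd_trim_condExpKernel_prod (hm : m ≤ mX) {A B : Set X} (hB : MeasurableSet[m] B)
    (hA : MeasurableSet A) : (ρ.trim hm ⊗ₘ condExpKernel ρ m) (B ×ˢ A) = ρ (B ∩ A) := by
  rw [compProd_trim_condExpKernel hm]
  exact Measure.map_apply (f := Function.diag) ((measurable_id'' hm).prodMk measurable_id)
    (hB.prod hA)

lemma setLIntegral_condExpKernel (hm : m ≤ mX) {A B : Set X} (hB : MeasurableSet[m] B)
    (hA : MeasurableSet A) : ∫⁻ x in B, condExpKernel ρ m x A ∂ρ = ρ (B ∩ A) := by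
  rw [← compProd_trim_condExpKernel_prod hm hB hA, Measure.compProd_apply_prod hB hA,
    restrict_trim hm _ hB, lintegral_trim hm (measurable_condExpKernel hA)]

/-- Conditioning on invariant events produces invariant measures. -/
lemma condExpKernel_map_ae_eq (hm : m ≤ mX) {T : X → X} (hT : MeasurePreserving T ρ ρ)
    (hinv : ∀ B, MeasurableSet[m] B → T ⁻¹' B = B) :
    ∀ᵐ x ∂ρ, (condExpKernel ρ m x).map T = condExpKernel ρ m x := by
  have h : ρ.trim hm ⊗ₘ (condExpKernel ρ m).map T = ρ.trim hm ⊗ₘ condExpKernel ρ m := by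
    have := Kernel.IsMarkovKernel.map (condExpKernel ρ m) hT.measurable
    refine Measure.ext_prod fun {B A} hB hA => ?_
    rw [compProd_trim_condExpKernel_prod hm hB hA, Measure.compProd_apply_prod hB hA]
    simp_rw [Kernel.map_apply' _ hT.measurable _ hA]
    rw [← Measure.compProd_apply_prod hB (hT.measurable hA),
      compProd_trim_condExpKernel_prod hm hB (hT.measurable hA)]
    -- Writing `B` as `T ⁻¹' B` turns the intersection into one preimage, whose measure `T`
    -- preserves.
    nth_rewrite 1 [← hinv B hB]
    rw [← preimage_inter]
    exact hT.measure_preimage ((hm _ hB).inter hA).nullMeasurableSet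
  have := Kernel.IsMarkovKernel.map (condExpKernel ρ m) hT.measurable
  filter_upwards [ae_of_ae_trim hm (Kernel.ae_eq_of_compProd_eq h)] with x hx
  rwa [Kernel.map_apply _ hT.measurable] at hx

end ProbabilityTheory

/-! ### The one-sided pointwise ergodic theorem -/

namespace ContinuousMap

open ProbabilityTheory

variable {Y : Type*} [TopologicalSpace Y] [MeasurableSpace Y] [BorelSpace Y]
  [MeasurableSpace C(ℝ≥0, Y)] [BorelSpace C(ℝ≥0, Y)]
  {ρ : Measure C(ℝ≥0, Y)} [IsProbabilityMeasure ρ]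

/-- By stationarity, the occupation time of the unit interval has the same integral over invariant
events as the event of visiting at time `0`. -/
lemma setLIntegral_occupation_one (hY : Measurable fun p : C(ℝ≥0, Y) × ℝ≥0 => p.1 p.2)
    (hρ : ∀ τ, MeasurePreserving (translate τ) ρ ρ) {s : Set Y} (hs : MeasurableSet s)
    {B : Set C(ℝ≥0, Y)} (hB : MeasurableSet[translateInvariants Y] B) :
    ∫⁻ u in B, occupation u 1 s ∂ρ = ρ (B ∩ (fun u => u 0) ⁻¹' s) := by
  have hm : Measurable fun p : C(ℝ≥0, Y) × ℝ => p.1 p.2.toNNReal :=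
    hY.comp (measurable_fst.prodMk (measurable_real_toNNReal.comp measurable_snd))
  obtain ⟨hBm, hBinv⟩ := measurableSet_translateInvariants.1 hB
  have h0 : Measurable fun u : C(ℝ≥0, Y) => u 0 := (continuous_eval_const 0).measurable
  -- As `B` is invariant, every time contributes equally; Tonelli then integrates over the unit
  -- interval.
  have h1 : ∀ t : ℝ, ρ.restrict B ((fun u : C(ℝ≥0, Y) => u t.toNNReal) ⁻¹' s)
      = ρ (B ∩ (fun u => u 0) ⁻¹' s) := by
    intro t
    have ht : Measurable fun u : C(ℝ≥0, Y) => u t.toNNReal := (continuous_eval_const _).measurable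
    rw [Measure.restrict_apply (ht hs), inter_comm,
      ← (hρ t.toNNReal).measure_preimage (hBm.inter (h0 hs)).nullMeasurableSet, preimage_inter,
      hBinv]
    congr 2
    ext u
    simp [translate_apply]
  calc ∫⁻ u in B, occupation u 1 s ∂ρ
      = ((ρ.restrict B).prod (volume.restrict (Ioc (0 : ℝ) 1)))
          ((fun p : C(ℝ≥0, Y) × ℝ => p.1 p.2.toNNReal) ⁻¹' s) := by
        rw [Measure.prod_apply (hm hs)]
        refine lintegral_congr fun u => ?_
        rw [occupation, Measure.map_apply u.measurable_comp_toNNReal hs]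
        rfl
    _ = ∫⁻ t in Ioc (0 : ℝ) 1, ρ.restrict B ((fun u : C(ℝ≥0, Y) => u t.toNNReal) ⁻¹' s) := by
        rw [Measure.prod_apply_symm (hm hs)]
        rfl
    _ = ρ (B ∩ (fun u => u 0) ⁻¹' s) := by
        simp_rw [h1]
        simp

variable [StandardBorelSpace C(ℝ≥0, Y)]

/-- The one-sided pointwise ergodic theorem for occupation times of a stationary path: the lower
asymptotic frequency dominates the conditional probability given the invariant events. -/
theorem condExpKernel_le_lowerFreq (hY : Measurable fun p : C(ℝ≥0, Y) × ℝ≥0 => p.1 p.2)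
    (hρ : ∀ τ, MeasurePreserving (translate τ) ρ ρ) {s : Set Y} (hs : MeasurableSet s) :
    ∀ᵐ u ∂ρ, condExpKernel ρ (translateInvariants Y) u ((fun v => v 0) ⁻¹' s)
      ≤ lowerFreq u s := by
  have hle : translateInvariants Y ≤ ‹MeasurableSpace C(ℝ≥0, Y)› := translateInvariants_le
  have h0 : MeasurableSet ((fun v : C(ℝ≥0, Y) => v 0) ⁻¹' s) :=
    (continuous_eval_const 0).measurable hs
  set κ : C(ℝ≥0, Y) → ℝ≥0∞ := fun u =>
    condExpKernel ρ (translateInvariants Y) u ((fun v => v 0) ⁻¹' s)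
  have hκ : Measurable[translateInvariants Y] κ := measurable_condExpKernel h0
  have hκ1 : ∀ u, κ u ≤ 1 := fun u => prob_le_one
  have hF1 : ∀ u : C(ℝ≥0, Y), occupation u 1 s ≤ 1 := fun u => by
    simpa using occupation_le u 1 s
  have hFm := measurable_occupation hY 1 hs
  have hint : ∀ g : C(ℝ≥0, Y) → ℝ≥0∞, Measurable g → (∀ u, g u ≤ 1) →
      Integrable (fun u => (g u).toReal) ρ := fun g hg hg1 =>
    Integrable.of_bound hg.ennreal_toReal.aestronglyMeasurable 1
      (Eventually.of_forall fun u => by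
        rw [Real.norm_of_nonneg ENNReal.toReal_nonneg]
        exact ENNReal.toReal_le_of_le_ofReal zero_le_one (by simpa using hg1 u))
  have hκi := hint κ (hκ.mono hle le_rfl) hκ1
  have hFi := hint _ hFm hF1
  have hκε : ∀ ε : ℝ, Integrable (fun u => (κ u).toReal - ε) ρ := fun ε =>
    hκi.sub (integrable_const ε)
  have key : ∀ k : ℕ, ρ {u | lowerFreq u s < ENNReal.ofReal ((κ u).toReal - 1 / (k + 1))} = 0 := by
    intro k
    set ε : ℝ := 1 / (k + 1)
    have hε : 0 < ε := Nat.one_div_pos_of_nat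
    -- The bad set is invariant because `lowerFreq` and `κ` are. The maximal inequality on it will
    -- force `0 ≤ -ε * ρ.real B`.
    set B := {u | lowerFreq u s < ENNReal.ofReal ((κ u).toReal - ε)}
    have hB : MeasurableSet[translateInvariants Y] B :=
      measurableSet_lt (measurable_lowerFreq hY hs) (hκ.ennreal_toReal.sub_const ε).ennreal_ofReal
    obtain ⟨hBm, hBinv⟩ := measurableSet_translateInvariants.1 hB
    have hpos : ∀ u ∈ B, ∃ n, 0 < birkhoffSum (translate 1)
        (fun u => ((κ u).toReal - ε) - (occupation u 1 s).toReal) n u := by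
      intro u hu
      have hu' : liminf (fun n => empirical u n s) atTop < ENNReal.ofReal ((κ u).toReal - ε) := hu
      obtain ⟨n, hn⟩ := (frequently_lt_of_liminf_lt (h := hu')).exists
      -- `empirical u n` averages up to time `n + 1`.
      refine ⟨n + 1, ?_⟩
      rw [birkhoffSum_translate_one s _ fun u => by
        rw [apply_translate_of_measurable hκ]]
      have h1 := ENNReal.toReal_lt_of_lt_ofReal hn
      rw [empirical_apply, ENNReal.toReal_mul, ENNReal.toReal_inv,
        ENNReal.toReal_add (by finiteness) (by finiteness)] at h1
      simp only [ENNReal.toReal_natCast, ENNReal.toReal_one] at h1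
      rw [inv_mul_lt_iff₀ (by positivity)] at h1
      push_cast
      linarith
    have hnonneg := setIntegral_nonneg_of_exists_birkhoffSum_pos (hρ 1)
      (((hκ.mono hle le_rfl).ennreal_toReal.sub_const ε).sub hFm.ennreal_toReal)
      ((hκε ε).sub hFi) hBm (hBinv 1) hpos
    -- Both equal the probability of `B` together with a visit to `s` at time `0`: one by
    -- conditioning, the other by stationarity.
    have heq : ∫ u in B, (κ u).toReal ∂ρ = ∫ u in B, (occupation u 1 s).toReal ∂ρ := by
      rw [integral_toReal (hκ.mono hle le_rfl).aemeasurable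
          (Eventually.of_forall fun u => (hκ1 u).trans_lt ENNReal.one_lt_top),
        integral_toReal hFm.aemeasurable
          (Eventually.of_forall fun u => (hF1 u).trans_lt ENNReal.one_lt_top),
        setLIntegral_condExpKernel hle hB h0, setLIntegral_occupation_one hY hρ hs hB]
    have hsplit : ∫ u in B, (((κ u).toReal - ε) - (occupation u 1 s).toReal) ∂ρ
        = -(ε * ρ.real B) := by
      rw [integral_sub (hκε ε).integrableOn hFi.integrableOn,
        integral_sub hκi.integrableOn (integrable_const ε).integrableOn, heq, setIntegral_const,
        smul_eq_mul]
      ring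
    have hzero : ρ.real B ≤ 0 := by
      have : ε * ρ.real B ≤ 0 := by
        simp only [Pi.sub_apply] at hnonneg
        linarith
      exact nonpos_of_mul_nonpos_right this hε
    exact (measureReal_eq_zero_iff).1 (le_antisymm hzero measureReal_nonneg)
  have hall : ∀ᵐ u ∂ρ, ∀ k : ℕ, ENNReal.ofReal ((κ u).toReal - 1 / (k + 1)) ≤ lowerFreq u s :=
    ae_all_iff.2 fun k => by
      rw [ae_iff]
      simpa only [not_le] using key k
  filter_upwards [hall] with u hu
  have hlim : Tendsto (fun k : ℕ => ENNReal.ofReal ((κ u).toReal - 1 / (k + 1))) atTop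
      (𝓝 (ENNReal.ofReal ((κ u).toReal - 0))) :=
    ENNReal.tendsto_ofReal (tendsto_one_div_add_atTop_nhds_zero_nat.const_sub _)
  rw [sub_zero, ENNReal.ofReal_toReal ((hκ1 u).trans_lt ENNReal.one_lt_top).ne] at hlim
  exact le_of_tendsto' hlim hu

end ContinuousMap

/-! ### Convergence of time averages -/

/-- Time averages of a bounded function converge along real times once they converge along
integer times. -/
lemma tendsto_intervalAverage_of_nat {g : ℝ → ℝ} {C c : ℝ} (hC : ∀ t, ‖g t‖ ≤ C)
    (hg : ∀ a b, IntervalIntegrable g volume a b)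
    (h : Tendsto (fun n : ℕ => (1 / ((n : ℝ) + 1)) * ∫ t in (0 : ℝ)..(n + 1), g t) atTop (𝓝 c)) :
    Tendsto (fun T : ℝ => (1 / T) * ∫ t in (0 : ℝ)..T, g t) atTop (𝓝 c) := by
  set I : ℝ → ℝ := fun T => ∫ t in (0 : ℝ)..T, g t
  have h1 : Tendsto (fun n : ℕ => (1 / (n : ℝ)) * I n) atTop (𝓝 c) :=
    (tendsto_add_atTop_iff_nat 1).1 (by simpa [I] using h)
  have h2 : Tendsto (fun T : ℝ => ((⌊T⌋₊ : ℝ) / T) * ((1 / (⌊T⌋₊ : ℝ)) * I ⌊T⌋₊)) atTop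
      (𝓝 (1 * c)) :=
    (tendsto_nat_floor_div_atTop (R := ℝ)).mul (h1.comp tendsto_nat_floor_atTop)
  -- The difference is the integral over `[⌊T⌋₊, T]` divided by `T`, at most `C / T`.
  have h3 : Tendsto (fun T : ℝ => (1 / T) * I T
      - ((⌊T⌋₊ : ℝ) / T) * ((1 / (⌊T⌋₊ : ℝ)) * I ⌊T⌋₊)) atTop (𝓝 0) := by
    refine squeeze_zero_norm' ?_ (tendsto_const_nhds.div_atTop tendsto_id : Tendsto
      (fun T : ℝ => C / T) atTop (𝓝 0))
    filter_upwards [eventually_ge_atTop 1] with T hT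
    have hT0 : 0 < T := by linarith
    have hfl : (0 : ℝ) < ⌊T⌋₊ := by exact_mod_cast Nat.floor_pos.2 hT
    have hle : (⌊T⌋₊ : ℝ) ≤ T := Nat.floor_le hT0.le
    have heq : (1 / T) * I T - ((⌊T⌋₊ : ℝ) / T) * ((1 / (⌊T⌋₊ : ℝ)) * I ⌊T⌋₊)
        = (∫ t in (⌊T⌋₊ : ℝ)..T, g t) / T := by
      rw [← intervalIntegral.integral_interval_sub_left (hg 0 T) (hg 0 ⌊T⌋₊)]
      field_simp
      rfl
    rw [heq, norm_div, Real.norm_of_nonneg hT0.le]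
    gcongr
    refine (intervalIntegral.norm_integral_le_of_norm_le_const fun t _ => hC t).trans ?_
    have hC0 : 0 ≤ C := (norm_nonneg _).trans (hC 0)
    rw [abs_of_nonneg (by linarith)]
    nlinarith [Nat.lt_floor_add_one T]
  simpa using h3.add h2

namespace MeasureTheory

/-- Given a countable network of measurable sets, it suffices to check the portmanteau condition on
finite unions of its members. -/
lemma le_liminf_of_network {Y : Type*} [TopologicalSpace Y] [MeasurableSpace Y]
    {D : ℕ → Set Y} (hD : ∀ O : Set Y, IsOpen O → ∀ x ∈ O, ∃ i, x ∈ D i ∧ D i ⊆ O)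
    {μ : Measure Y} {ν : ℕ → Measure Y}
    (h : ∀ F : Finset ℕ, μ (⋃ i ∈ F, D i) ≤ liminf (fun n => ν n (⋃ i ∈ F, D i)) atTop)
    {O : Set Y} (hO : IsOpen O) : μ O ≤ liminf (fun n => ν n O) atTop := by
  let s (F : Finset ℕ) : Set Y := ⋃ i ∈ F, D i
  let t : Set (Finset ℕ) := {F | s F ⊆ O}
  have hOs : O = ⋃ F ∈ t, s F := by
    refine Subset.antisymm (fun x hx => ?_) (iUnion₂_subset fun F hF => hF)
    obtain ⟨i, hxi, hi⟩ := hD O hO x hx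
    exact mem_iUnion₂.2 ⟨{i}, by simpa [t, s] using hi, by simpa [s] using hxi⟩
  -- Finite unions, unlike single members, form a directed family; it is countable, so continuity
  -- from below applies.
  have hdir : DirectedOn (Function.onFun (· ⊆ ·) s) t := by
    classical
    refine fun F hF G hG => ⟨F ∪ G, ?_, ?_, ?_⟩
    · simp only [t, s, mem_ofPred_eq, Finset.set_biUnion_union]
      exact union_subset hF hG
    · exact biUnion_subset_biUnion_left Finset.subset_union_left
    · exact biUnion_subset_biUnion_left Finset.subset_union_right
  conv_lhs => rw [hOs, measure_biUnion_eq_iSup t.to_countable hdir]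
  exact iSup₂_le fun F hF => (h F).trans
    (liminf_le_liminf (Eventually.of_forall fun n => measure_mono hF))

end MeasureTheory

namespace WeakSpace

variable {E : Type*} [NormedAddCommGroup E] [InnerProductSpace ℝ E] [CompleteSpace E]
  [SecondCountableTopology E]
  [MeasurableSpace C(ℝ≥0, WeakSpace ℝ E)] [BorelSpace C(ℝ≥0, WeakSpace ℝ E)]

/-- Each coordinate is continuous in time and measurable in the path, hence jointly measurable for
the product σ-algebra. -/
lemma measurable_path_eval [MeasurableSpace (WeakSpace ℝ E)] [BorelSpace (WeakSpace ℝ E)] :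
    Measurable fun p : C(ℝ≥0, WeakSpace ℝ E) × ℝ≥0 => p.1 p.2 := by
  refine measurableEmbedding_coord.measurable_comp_iff.1 (measurable_pi_lambda _ fun k => ?_)
  have hk : Continuous fun x : WeakSpace ℝ E => coord x k :=
    (continuous_apply k).comp continuous_coord
  have := measurable_uncurry_of_continuous_of_measurable
    (u := fun (t : ℝ≥0) (u : C(ℝ≥0, WeakSpace ℝ E)) => coord (u t) k)
    (fun u => hk.comp u.continuous)
    (fun t => (hk.comp (continuous_eval_const t)).measurable)
  exact this.comp measurable_swap

/-- Invariance under a dense set of time translations implies invariance under all of them. -/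
lemma map_translate_eq_of_dense {κ : Measure C(ℝ≥0, WeakSpace ℝ E)} [IsFiniteMeasure κ]
    {S : Set ℝ≥0} (hS : Dense S) (h : ∀ τ ∈ S, κ.map (ContinuousMap.translate τ) = κ) (τ : ℝ≥0) :
    κ.map (ContinuousMap.translate τ) = κ := by
  let _ : MeasurableSpace C(ℝ≥0, ℕ → ℝ) := borel _
  have : BorelSpace C(ℝ≥0, ℕ → ℝ) := ⟨rfl⟩
  have hJ := measurableEmbedding_pathCoord (E := E)
  have htr := fun τ => ContinuousMap.measurable_translate (Y := WeakSpace ℝ E) τ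
  have hfin : ∀ τ, IsFiniteMeasure (κ.map (ContinuousMap.translate τ)) := fun τ =>
    Measure.isFiniteMeasure_map κ _
  suffices hs : (κ.map (ContinuousMap.translate τ)).map pathCoord = κ.map pathCoord by
    rw [← hJ.comap_map (κ.map _), hs, hJ.comap_map]
  have := Measure.isFiniteMeasure_map κ (pathCoord (E := E))
  have := Measure.isFiniteMeasure_map (κ.map (ContinuousMap.translate τ)) (pathCoord (E := E))
  refine ext_of_forall_integral_eq_of_IsFiniteMeasure fun f => ?_
  have hfJ : Continuous fun u : C(ℝ≥0, WeakSpace ℝ E) => f (pathCoord u) :=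
    f.continuous.comp continuous_pathCoord
  rw [integral_map hJ.measurable.aemeasurable f.continuous.aestronglyMeasurable,
    integral_map hJ.measurable.aemeasurable f.continuous.aestronglyMeasurable]
  have hint : ∀ σ, ∫ u, f (pathCoord u) ∂(κ.map (ContinuousMap.translate σ))
      = ∫ u, f (pathCoord (ContinuousMap.translate σ u)) ∂κ := fun σ =>
    integral_map (htr σ).aemeasurable hfJ.measurable.aestronglyMeasurable
  -- Dominated convergence, using continuity of `σ ↦ translate σ u` for each path.
  have hcont : Continuous fun σ => ∫ u, f (pathCoord (ContinuousMap.translate σ u)) ∂κ := by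
    refine continuous_of_dominated (bound := fun _ => ‖f‖)
      (fun σ => (hfJ.measurable.comp (htr σ)).aestronglyMeasurable)
      (fun σ => Eventually.of_forall fun u => f.norm_coe_le_norm _) (integrable_const _)
      (Eventually.of_forall fun u => hfJ.comp (ContinuousMap.continuous_translate_time u))
  rw [hint]
  have := Continuous.ext_on hS hcont
    (continuous_const (y := ∫ u, f (pathCoord u) ∂κ)) fun σ hσ => by
      rw [← hint, h σ hσ]
  exact congrFun this τ

end WeakSpace

/-! ### Application to Vishik–Fursikov measures -/

namespace NSE

variable {Ω : Set E3}

instance : CompleteSpace (H Ω) :=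
  (Submodule.isClosed_topologicalClosure _).completeSpace_coe

instance : SecondCountableTopology (H Ω) :=
  have : Fact ((2 : ℝ≥0∞) ≠ ⊤) := ⟨by simp⟩
  TopologicalSpace.Subtype.secondCountableTopology _

instance : StandardBorelSpace (Cw Ω) := WeakSpace.standardBorelSpace_paths

lemma intervalIntegrable_path (Φ : BoundedContinuousFunction (Hw Ω) ℝ) (u : Cw Ω) (a b : ℝ) :
    IntervalIntegrable (fun t : ℝ => Φ (u t.toNNReal)) volume a b :=
  (Φ.continuous.comp (u.continuous.comp continuous_real_toNNReal)).intervalIntegrable a b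

lemma memLp_timeAverage (Φ : BoundedContinuousFunction (Hw Ω) ℝ) (u : Cw Ω) :
    MemLp (timeAverage Φ u) ∞ (volume.restrict (Ioi (0 : ℝ))) := by
  refine memLp_top_of_bound (C := ‖Φ‖) ?_ ?_
  · refine Measurable.aestronglyMeasurable ?_
    exact (measurable_const.div measurable_id).mul
      (intervalIntegral.continuous_primitive (intervalIntegrable_path Φ u) 0).measurable
  · filter_upwards [ae_restrict_mem measurableSet_Ioi] with T hT
    have hT0 : (0 : ℝ) < T := hT
    have := intervalIntegral.norm_integral_le_of_norm_le_const (a := 0) (b := T)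
      (f := fun t : ℝ => Φ (u t.toNNReal)) fun t _ => Φ.norm_coe_le_norm _
    rw [sub_zero, abs_of_pos hT0] at this
    rw [timeAverage, norm_mul, Real.norm_of_nonneg (by positivity), one_div,
      inv_mul_le_iff₀ hT0, mul_comm]
    exact this

lemma representsTimeAverages_of_tendsto {L : LInfty →L[ℝ] ℝ} (hL : IsGeneralizedLimit L)
    {u : Cw Ω} {μ : Measure (Hw Ω)}
    (h : ∀ Φ : BoundedContinuousFunction (Hw Ω) ℝ,
      Tendsto (timeAverage Φ u) atTop (𝓝 (∫ v, Φ v ∂μ))) :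
    RepresentsTimeAverages L u μ := fun Φ =>
  ⟨memLp_timeAverage Φ u, hL.extends_lim _ _ _ (h Φ)⟩

/-- Weak convergence of the empirical measures gives convergence of all time averages. -/
lemma tendsto_timeAverage_of_le_lowerFreq {u : Cw Ω} {μ : Measure (Hw Ω)} [IsProbabilityMeasure μ]
    (h : ∀ O, IsOpen O → μ O ≤ u.lowerFreq O) (Φ : BoundedContinuousFunction (Hw Ω) ℝ) :
    Tendsto (timeAverage Φ u) atTop (𝓝 (∫ v, Φ v ∂μ)) := by
  have hlim := ProbabilityMeasure.tendsto_iff_forall_integral_tendsto.1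
    (tendsto_of_forall_isOpen_le_liminf_nat' (μ := ⟨μ, inferInstance⟩)
      (μs := fun n => ⟨u.empirical n, inferInstance⟩) h) Φ
  refine tendsto_intervalAverage_of_nat (fun t => Φ.norm_coe_le_norm _)
    (intervalIntegrable_path Φ u) (hlim.congr fun n => ?_)
  change ∫ v, Φ v ∂(u.empirical n) = _
  rw [ContinuousMap.empirical, integral_smul_measure, ContinuousMap.integral_occupation u _
    Φ.continuous.measurable.aestronglyMeasurable, ENNReal.toReal_inv,
    ENNReal.toReal_add (by finiteness) (by finiteness)]
  simp

open ProbabilityTheory in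
theorem exists_stationary_of_invariant {ν : ℝ} {f : H Ω} {ρ : Measure (Cw Ω)}
    (hρ : IsInvariantVF ν f ρ) :
    ∀ᵐ u ∂ρ, ∃ μ : Measure (Hw Ω), IsProbabilityMeasure μ ∧ IsVFStationary ν f μ ∧
      ∀ Φ : BoundedContinuousFunction (Hw Ω) ℝ,
        Tendsto (timeAverage Φ u) atTop (𝓝 (∫ v, Φ v ∂μ)) := by
  have := hρ.isProbabilityMeasure
  have hpres : ∀ τ, MeasurePreserving (ContinuousMap.translate τ) ρ ρ := fun τ =>
    ⟨ContinuousMap.measurable_translate τ, Measure.ext fun A hA => by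
      rw [Measure.map_apply (ContinuousMap.measurable_translate τ) hA]
      exact hρ.invariant τ A hA⟩
  have hle : ContinuousMap.translateInvariants (Hw Ω) ≤ instMeasurableSpaceCw Ω :=
    ContinuousMap.translateInvariants_le
  obtain ⟨D, hDm, hD⟩ := WeakSpace.exists_seq_measurableSet_network (E := H Ω)
  have hfreq : ∀ᵐ u ∂ρ, ∀ F : Finset ℕ,
      condExpKernel ρ (ContinuousMap.translateInvariants (Hw Ω)) u ((fun v => v 0) ⁻¹' ⋃ i ∈ F, D i)
        ≤ u.lowerFreq (⋃ i ∈ F, D i) :=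
    ae_all_iff.2 fun F => ContinuousMap.condExpKernel_le_lowerFreq
      WeakSpace.measurable_path_eval hpres (F.measurableSet_biUnion fun i _ => hDm i)
  -- The null set for conditional invariance depends on the time, so only a countable dense set of
  -- times is treated here.
  have hinv : ∀ᵐ u ∂ρ, ∀ k, (condExpKernel ρ (ContinuousMap.translateInvariants (Hw Ω)) u).map
      (ContinuousMap.translate (TopologicalSpace.denseSeq ℝ≥0 k))
        = condExpKernel ρ (ContinuousMap.translateInvariants (Hw Ω)) u :=
    ae_all_iff.2 fun k => condExpKernel_map_ae_eq hle (hpres _)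
      fun B hB => (ContinuousMap.measurableSet_translateInvariants.1 hB).2 _
  have hcarried : ∀ᵐ u ∂ρ, ∀ᵐ v ∂(condExpKernel ρ (ContinuousMap.translateInvariants (Hw Ω)) u),
      IsLerayHopf ν f v :=
    -- Averaging the conditional measures returns `ρ`, so a `ρ`-null set is null for almost every
    -- one of them.
    ae_of_ae_trim hle (Measure.ae_ae_of_ae_comp (by
      rw [condExpKernel_comp_trim hle]; exact hρ.carried))
  filter_upwards [hfreq, hinv, hcarried] with u hu1 hu2 hu3
  set κ := condExpKernel ρ (ContinuousMap.translateInvariants (Hw Ω)) u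
  have h0 : Measurable (proj0 : Cw Ω → Hw Ω) := (continuous_eval_const 0).measurable
  have hκ : IsInvariantVF ν f κ := by
    refine ⟨inferInstance, hu3, fun τ A hA => ?_⟩
    have := WeakSpace.map_translate_eq_of_dense (κ := κ) (TopologicalSpace.denseRange_denseSeq ℝ≥0)
      (by rintro _ ⟨k, rfl⟩; exact hu2 k) τ
    conv_rhs => rw [← this, Measure.map_apply (ContinuousMap.measurable_translate τ) hA]
    rfl
  have hμ : IsProbabilityMeasure (κ.map proj0) := Measure.isProbabilityMeasure_map h0.aemeasurable
  refine ⟨κ.map proj0, hμ, ⟨κ, hκ, rfl⟩, tendsto_timeAverage_of_le_lowerFreq fun O hO => ?_⟩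
  refine le_liminf_of_network hD (fun F => ?_) hO
  rw [Measure.map_apply h0 (F.measurableSet_biUnion fun i _ => hDm i)]
  exact hu1 F

end NSE

theorem theorem1p2 {Ω : Set NSE.E3} (hΩ : NSE.IsBoundedSmoothDomain Ω)
    (ν : ℝ) (hν : 0 < ν) (f : NSE.H Ω)
    (ρ : Measure (NSE.Cw Ω)) (hρ : NSE.IsInvariantVF ν f ρ)
    (Lim Lim' : NSE.LInfty →L[ℝ] ℝ)
    (hLim : NSE.IsGeneralizedLimit Lim) (hLim' : NSE.IsGeneralizedLimit Lim') :
    ∀ᵐ u ∂ρ, NSE.IsLerayHopf ν f u ∧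
      (∃ μ : Measure (NSE.Hw Ω), NSE.IsVFStationary ν f μ ∧
        NSE.RepresentsTimeAverages Lim u μ ∧ NSE.RepresentsTimeAverages Lim' u μ) ∧
      ∀ μ μ' : Measure (NSE.Hw Ω), IsProbabilityMeasure μ → IsProbabilityMeasure μ' →
        NSE.RepresentsTimeAverages Lim u μ → NSE.RepresentsTimeAverages Lim' u μ' → μ = μ' := by
  filter_upwards [hρ.carried, NSE.exists_stationary_of_invariant hρ] with u hu ⟨μ₀, _, hμ₀, htend⟩
  have h := NSE.representsTimeAverages_of_tendsto hLim htend
  have h' := NSE.representsTimeAverages_of_tendsto hLim' htend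
  refine ⟨hu, ⟨μ₀, hμ₀, h, h'⟩, fun μ μ' _ _ hμ hμ' => ?_⟩
  -- Both integrals equal the classical limit `∫ Φ dμ₀`.
  refine WeakSpace.ext_of_forall_integral_eq fun Φ => ?_
  obtain ⟨_, h1⟩ := h Φ
  obtain ⟨_, h2⟩ := h' Φ
  obtain ⟨_, h3⟩ := hμ Φ
  obtain ⟨_, h4⟩ := hμ' Φ
  rw [← h3, ← h4, h1, h2]
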